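/- Let $\mathrm{elh}(\mathbb C)$ be the set of entire functions $f$ with $f'(z)\neq 0$ for all $z\in\mathbb C$ and $f'(0)=1$, and let $E\supseteq \mathrm{elh}(\mathbb C)$ be the set of all entire functions with nowhere vanishing derivative. Both carry the topology of uniform convergence on compact subsets of $\mathbb C$. For $f\in\mathrm{elh}(\mathbb C)$ put $R_f(\mathrm{elh}(\mathbb C))=\{g\circ f : g\in \mathrm{elh}(\mathbb C)\}$. Suppose that $f\in\mathrm{elh}(\mathbb C)$ is not a translation $z\mapsto z+a$, $a\in\mathbb C$. Then: 1. The set $I_f=R_f(\mathrm{elh}(\mathbb C))\cap \mathrm{elh}(\mathbb C)$ is closed in $\mathrm{elh}(\mathbb C)$ and has empty interior in $\mathrm{elh}(\mathbb C)$; hence its boundary in $\mathrm{elh}(\mathbb C)$ is $\partial I_f=I_f$. 2. If $f(0)=0$, then $R_f(\mathrm{elh}(\mathbb C))\subseteq \mathrm{elh}(\mathbb C)$, so that $I_f=R_f(\mathrm{elh}(\mathbb C))$ and item 1 says $\partial R_f(\mathrm{elh}(\mathbb C))=R_f(\mathrm{elh}(\mathbb C))$ in $\mathrm{elh}(\mathbb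 C)$. 3. Without any assumption on $f(0)$, $R_f(\mathrm{elh}(\mathbb C))$ is a subset of $E$, it is closed in $E$ and has empty interior in $E$; hence its boundary in $E$ is $R_f(\mathrm{elh}(\mathbb C))$. -/

import Mathlib

/-- Entire functions with nowhere vanishing derivative (no normalization). As subsets of `C(ℂ, ℂ)`
they carry Mathlib's compact-open topology, which is the topology of compact convergence
(`ContinuousMap.tendsto_iff_forall_isCompact_tendstoUniformlyOn`). -/
def entireLocalHomeo : Set C(ℂ, ℂ) :=
  {f | Differentiable ℂ f ∧ ∀ z : ℂ, deriv f z ≠ 0}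

/-- `elh(ℂ)`: entire functions with nowhere vanishing derivative and `f'(0) = 1`. -/
def elh : Set C(ℂ, ℂ) :=
  {f | Differentiable ℂ f ∧ (∀ z : ℂ, deriv f z ≠ 0) ∧ deriv f 0 = 1}

/-- `Aut(ℂ)`: the translations `z ↦ z + a`. -/
def translations : Set C(ℂ, ℂ) :=
  {f | ∃ a : ℂ, ∀ z : ℂ, f z = z + a}

/-- `R_f(elh(ℂ)) = {g ∘ f | g ∈ elh(ℂ)}`. -/
def rightImage (f : C(ℂ, ℂ)) : Set C(ℂ, ℂ) :=
  (fun g : C(ℂ, ℂ) => g.comp f) '' elh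

/-- The part of `R_f(elh(ℂ))` lying in `X`, as a subset of the topological space `X` (with the
subspace topology). -/
def rightImageIn (X : Set C(ℂ, ℂ)) (f : C(ℂ, ℂ)) : Set X :=
  {h | (h : C(ℂ, ℂ)) ∈ rightImage f}

/-!
Composition with `f` is a uniform embedding of `elh` into the space of continuous functions, with
closed image; the image has empty interior because `f` is not injective.

*Closedness.* The map `f` is open, and by Picard's little theorem
(`exists_compl_singleton_subset_range`) it omits at most one value. Hence every large circle lies in
the image under `f` of a compact set, and by the maximum principle an entire function `g` is
controlled on a given compact set by `g ∘ f` on another one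
(`exists_isCompact_forall_norm_le_of_comp`). As `elh` is closed, hence complete, by Hurwitz's
theorem (`isClosed_elh`), the image of `elh` is complete, hence closed, already in `C(ℂ, ℂ)`
(`isClosed_rightImage`). Picard's theorem is obtained from a weak form of Bloch's theorem
(`exists_ball_subset_range_of_deriv_ne_zero`).

*Empty interior.* An injective entire function is affine (`eq_add_deriv_mul_of_injective`), so `f`,
not being a translation, identifies two distinct points `a` and `b`, and then so does every `g ∘ f`.
But an `h` without critical points and with `h a = h b` is a limit of functions without critical
points, with the same derivative at `0`, that separate `a` and `b` (`exists_tendsto_ne`): take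
primitives of `h' exp (ε W' / h')`, which are `h + ε W + O(ε²)`, for an entire `W` with `W 0 = 0`,
`W' 0 = 0` and `W a ≠ W b`.
-/

open Metric Set Filter Topology

/-! ### Entire logarithms and arccosines -/

theorem exists_differentiable_exp_eq {u : ℂ → ℂ} (hu : Differentiable ℂ u) (h0 : ∀ z, u z ≠ 0) :
    ∃ L : ℂ → ℂ, Differentiable ℂ L ∧ ∀ z, Complex.exp (L z) = u z := by
  have hq : Differentiable ℂ fun z => deriv u z / u z := hu.deriv.div hu h0
  obtain ⟨L, hL0, hL⟩ := hq.isExactOn_univ.with_val_at 0 (Complex.log (u 0))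
  have hLd : Differentiable ℂ L := fun z => (hL z (mem_univ z)).differentiableAt
  refine ⟨L, hLd, fun z => ?_⟩
  have hconst : ∀ w, deriv (fun z => u z * Complex.exp (-L z)) w = 0 := fun w => by
    have h : HasDerivAt (fun z => u z * Complex.exp (-L z)) _ w :=
      (hu w).hasDerivAt.mul (hL w (mem_univ w)).neg.cexp
    rw [h.deriv, Pi.neg_apply]
    have := h0 w
    field_simp
    ring
  have key := is_const_of_deriv_eq_zero (hu.mul hLd.neg.cexp) hconst z 0
  simp only [Pi.mul_apply, Pi.neg_apply, hL0] at key
  rw [Complex.exp_neg, Complex.exp_neg, Complex.exp_log (h0 0), mul_inv_cancel₀ (h0 0)] at key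
  have hne := Complex.exp_ne_zero (L z)
  field_simp at key
  exact key.symm

/-- An entire function omitting `1` and `-1` is the cosine of an entire function: with `s` an
entire square root of `1 - u ^ 2`, the function `u + i s` has no zero and is therefore `exp (i π F)`,
with inverse `u - i s`. The factor `π` makes the integers the points where the outer cosine
is `±1`. -/
theorem exists_differentiable_cos_pi_mul_eq {u : ℂ → ℂ} (hu : Differentiable ℂ u)
    (h1 : ∀ z, u z ≠ 1) (h2 : ∀ z, u z ≠ -1) :
    ∃ F : ℂ → ℂ, Differentiable ℂ F ∧ ∀ z, Complex.cos (Real.pi * F z) = u z := by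
  have hne : ∀ z, 1 - u z ^ 2 ≠ 0 := fun z h => by
    have : (u z - 1) * (u z + 1) = 0 := by linear_combination -h
    rcases mul_eq_zero.1 this with h | h
    · exact h1 z (by linear_combination h)
    · exact h2 z (by linear_combination h)
  obtain ⟨L, hL, hLe⟩ := exists_differentiable_exp_eq ((hu.pow 2).const_sub 1) hne
  have hs2 : ∀ z, Complex.exp (L z / 2) ^ 2 = 1 - u z ^ 2 := fun z => by
    have h := hLe z
    simp only [Pi.pow_apply] at h
    rw [← h, ← Complex.exp_nat_mul]
    congr 1
    push_cast
    ring
  have hsd : Differentiable ℂ fun z => Complex.exp (L z / 2) := (hL.div_const 2).cexp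
  have hprod : ∀ z, (u z + Complex.I * Complex.exp (L z / 2)) *
      (u z - Complex.I * Complex.exp (L z / 2)) = 1 := fun z => by
    linear_combination hs2 z - Complex.exp (L z / 2) ^ 2 * Complex.I_sq
  have hvne : ∀ z, u z + Complex.I * Complex.exp (L z / 2) ≠ 0 := fun z =>
    left_ne_zero_of_mul_eq_one (hprod z)
  obtain ⟨G, hG, hGe⟩ := exists_differentiable_exp_eq (hu.add (hsd.const_mul Complex.I)) hvne
  have hpi : (Real.pi : ℂ) ≠ 0 := by exact_mod_cast Real.pi_ne_zero
  refine ⟨fun z => G z / (Complex.I * Real.pi), hG.div_const _, fun z => ?_⟩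
  have e1 : Real.pi * (G z / (Complex.I * Real.pi)) * Complex.I = G z := by
    have := Complex.I_ne_zero
    field_simp
  have h := hGe z
  simp only [Pi.add_apply] at h
  have e2 : (Complex.exp (G z))⁻¹ = u z - Complex.I * Complex.exp (L z / 2) := by
    rw [h]
    exact inv_eq_of_mul_eq_one_right (hprod z)
  rw [Complex.cos, neg_mul, e1, Complex.exp_neg, e2, h]
  ring

/-! ### Large discs in the range of an entire function -/

/-- If `|g'|` at most doubles on a disc, then `g` is close to its affine approximation on a
concentric disc of one sixth the radius, by the Schwarz lemma for `g'`, so the image of `g`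
contains a disc of comparable size. -/
theorem ball_subset_range_of_norm_deriv_le {g : ℂ → ℂ} (hg : Differentiable ℂ g)
    {c : ℂ} {t : ℝ} (ht : 0 < t) (h0 : deriv g c ≠ 0)
    (hb : ∀ z ∈ ball c t, ‖deriv g z‖ ≤ 2 * ‖deriv g c‖) :
    ball (g c) (‖deriv g c‖ * t / 24) ⊆ range g := by
  set D := ‖deriv g c‖ with hD
  have hDpos : 0 < D := norm_pos_iff.2 h0
  have hmaps : MapsTo (deriv g) (ball c t) (closedBall (deriv g c) (3 * D)) := fun z hz => by
    rw [mem_closedBall, dist_eq_norm]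
    linarith [norm_sub_le (deriv g z) (deriv g c), hb z hz]
  have hsmall : ∀ z ∈ closedBall c (t / 6), ‖deriv g z - deriv g c‖ ≤ D / 2 := fun z hz => by
    have hz' : dist z c ≤ t / 6 := hz
    have h := Complex.dist_le_div_mul_dist_of_mapsTo_ball hg.deriv.differentiableOn hmaps
      (mem_ball.2 (by linarith))
    rw [dist_eq_norm] at h
    refine h.trans ?_
    calc 3 * D / t * dist z c ≤ 3 * D / t * (t / 6) := by gcongr
      _ = D / 2 := by field_simp; norm_num
  have hlow : ∀ z ∈ sphere c (t / 6), D * t / 12 ≤ ‖g z - g c‖ := fun z hz => by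
    have hd : ∀ x, HasDerivAt (fun z => g z - deriv g c * z) (deriv g x - deriv g c) x := fun x => by
      simpa using (hg x).hasDerivAt.fun_sub ((hasDerivAt_id x).const_mul (deriv g c))
    have h := (convex_closedBall c (t / 6)).norm_image_sub_le_of_norm_hasDerivWithin_le
      (fun x _ => (hd x).hasDerivWithinAt) hsmall (mem_closedBall_self (by positivity))
      (sphere_subset_closedBall hz)
    have hzc : ‖z - c‖ = t / 6 := by rw [← dist_eq_norm]; exact hz
    rw [hzc] at h
    have e : deriv g c * (z - c) =
        (g z - g c) - (g z - deriv g c * z - (g c - deriv g c * c)) := by ring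
    have h3 := norm_sub_le (g z - g c) (g z - deriv g c * z - (g c - deriv g c * c))
    rw [← e, norm_mul, hzc, ← hD] at h3
    linarith
  have hfreq : ∃ᶠ z in 𝓝 c, g z ≠ g c :=
    ((hg c).hasDerivAt.eventually_ne h0).frequently.filter_mono nhdsWithin_le_nhds
  have h := hg.diffContOnCl.ball_subset_image_closedBall (by positivity : 0 < t / 6) hlow hfreq
  intro w hw
  obtain ⟨z, -, rfl⟩ := h (by rwa [show D * t / 12 / 2 = D * t / 24 by ring])
  exact mem_range_self z

/-- A weak form of **Bloch's theorem**: the range of a nonconstant entire function contains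
discs of every radius. -/
theorem exists_ball_subset_range_of_deriv_ne_zero {g : ℂ → ℂ} (hg : Differentiable ℂ g) {z₀ : ℂ}
    (h0 : deriv g z₀ ≠ 0) (R : ℝ) : ∃ w, ball w R ⊆ range g := by
  set D := ‖deriv g z₀‖ with hD
  have hDpos : 0 < D := norm_pos_iff.2 h0
  -- The constant is chosen so that the disc produced below has radius at least `R`.
  set r := 48 * (|R| + 1) / D with hr
  have hrpos : 0 < r := by positivity
  have hcont : Continuous fun z => ‖deriv g z‖ * (r - dist z z₀) := by
    have := hg.deriv.continuous
    fun_prop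
  obtain ⟨c, hc, hmax⟩ := (isCompact_closedBall z₀ r).exists_isMaxOn
    ⟨z₀, mem_closedBall_self hrpos.le⟩ hcont.continuousOn
  have hM : 48 * (|R| + 1) ≤ ‖deriv g c‖ * (r - dist c z₀) := by
    have h := hmax (mem_closedBall_self hrpos.le)
    simp only [mem_ofPred_eq, dist_self, sub_zero, ← hD] at h
    rwa [hr, mul_div_cancel₀ _ hDpos.ne', ← hr] at h
  have hprod : 0 < ‖deriv g c‖ * (r - dist c z₀) := lt_of_lt_of_le (by positivity) hM
  have hcpos : 0 < ‖deriv g c‖ := by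
    rcases (norm_nonneg (deriv g c)).eq_or_lt with h | h
    · rw [← h, zero_mul] at hprod; exact absurd hprod (lt_irrefl _)
    · exact h
  have htpos : 0 < r - dist c z₀ := pos_of_mul_pos_right hprod hcpos.le
  have hbound : ∀ z ∈ ball c ((r - dist c z₀) / 2), ‖deriv g z‖ ≤ 2 * ‖deriv g c‖ := fun z hz => by
    have hz' : dist z c < (r - dist c z₀) / 2 := hz
    have htri := dist_triangle z c z₀
    have h : ‖deriv g z‖ * (r - dist z z₀) ≤ ‖deriv g c‖ * (r - dist c z₀) :=
      hmax (mem_closedBall.2 (by linarith))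
    have h' : ‖deriv g z‖ * ((r - dist c z₀) / 2) ≤ ‖deriv g z‖ * (r - dist z z₀) := by
      gcongr
      linarith
    by_contra! hlt
    nlinarith
  refine ⟨g c, (ball_subset_ball ?_).trans
    (ball_subset_range_of_norm_deriv_le hg (half_pos htpos) (norm_pos_iff.1 hcpos) hbound)⟩
  linarith [le_abs_self R]

/-! ### Picard's little theorem -/

theorem exists_dist_lt_cos_pi_mul_eq_intCast (w : ℂ) :
    ∃ p : ℂ, dist p w < 2 ∧ ∃ n : ℤ, Complex.cos (Real.pi * p) = n := by
  -- On the lines `Re p ∈ ℤ` the function `cos (π p)` is `± cosh (π Im p)`.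
  have hcont : Continuous fun s : ℝ => Real.cosh (Real.pi * s) :=
    Real.continuous_cosh.comp (continuous_const.mul continuous_id)
  have hgrow : Real.cosh (Real.pi * |w.im|) + 1 ≤ Real.cosh (Real.pi * (|w.im| + 1)) := by
    rw [mul_add, mul_one, Real.cosh_add]
    have h1 : 2 ≤ Real.cosh Real.pi := by
      rw [Real.cosh_eq]
      linarith [Real.add_one_le_exp Real.pi, Real.exp_pos (-Real.pi), Real.pi_gt_three]
    have h2 := Real.one_le_cosh (Real.pi * |w.im|)
    have h3 : 0 ≤ Real.sinh (Real.pi * |w.im|) * Real.sinh Real.pi :=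
      mul_nonneg (Real.sinh_nonneg_iff.2 (by positivity)) (Real.sinh_nonneg_iff.2 (by positivity))
    nlinarith
  obtain ⟨s, ⟨hs1, hs2⟩, hs⟩ := intermediate_value_Icc
    (by linarith : |w.im| ≤ |w.im| + 1) hcont.continuousOn
    (show (⌈Real.cosh (Real.pi * |w.im|)⌉ : ℝ) ∈ _ from
      ⟨Int.le_ceil _, (Int.ceil_lt_add_one _).le.trans hgrow⟩)
  obtain ⟨s', hs'abs, hs'⟩ : ∃ s' : ℝ, |s' - w.im| ≤ 1 ∧
      Real.cosh (Real.pi * s') = Real.cosh (Real.pi * s) := by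
    rcases le_total 0 w.im with h | h
    · rw [abs_of_nonneg h] at hs1 hs2
      exact ⟨s, abs_le.2 ⟨by linarith, by linarith⟩, rfl⟩
    · rw [abs_of_nonpos h] at hs1 hs2
      exact ⟨-s, abs_le.2 ⟨by linarith, by linarith⟩, by rw [mul_neg, Real.cosh_neg]⟩
  refine ⟨round w.re + s' * Complex.I, ?_, ?_⟩
  · have hre := abs_sub_round w.re
    rw [dist_eq_norm]
    refine (Complex.norm_le_abs_re_add_abs_im _).trans_lt ?_
    simp only [Complex.sub_re, Complex.add_re, Complex.intCast_re, Complex.mul_re, Complex.ofReal_re,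
      Complex.I_re, mul_zero, Complex.ofReal_im, Complex.I_im, mul_one, sub_self, add_zero,
      Complex.sub_im, Complex.add_im, Complex.intCast_im, Complex.mul_im, zero_add]
    rw [abs_sub_comm]
    linarith
  · have e : (Real.pi : ℂ) * (round w.re + s' * Complex.I) =
        ((Real.pi * s' : ℝ) : ℂ) * Complex.I + (round w.re : ℤ) * Real.pi := by
      push_cast; ring
    simp only at hs
    rw [e, Complex.cos_antiperiodic.add_int_mul_eq, Complex.cos_mul_I, ← Complex.ofReal_cosh, hs', hs]
    exact ⟨(round w.re).negOnePow * ⌈Real.cosh (Real.pi * |w.im|)⌉, by push_cast; rfl⟩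

theorem cos_pi_mul_intCast (n : ℤ) :
    Complex.cos (Real.pi * n) = 1 ∨ Complex.cos (Real.pi * n) = -1 := by
  have h := Complex.cos_antiperiodic.add_int_mul_eq (x := 0) n
  rw [zero_add, Complex.cos_zero, mul_one, mul_comm] at h
  rw [h]
  exact (Int.even_or_odd n).imp (fun h => by simp [Int.negOnePow_even n h])
    fun h => by simp [Int.negOnePow_odd n h]

/-- **Picard's little theorem**: a nonconstant entire function omits at most one value.
If `f` omits two values, normalized to `±1`, then `f = cos (π F)`, where `F` omits all integers,
and `F = cos (π G)`, where `G` omits every point at which `cos (π ·)` is an integer. Those points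
meet every disc of radius `2`, whereas a nonconstant `G` would cover such a disc. -/
theorem exists_compl_singleton_subset_range {f : ℂ → ℂ} (hf : Differentiable ℂ f)
    {z₀ : ℂ} (h0 : deriv f z₀ ≠ 0) : ∃ p, {p}ᶜ ⊆ range f := by
  by_contra! hcon
  obtain ⟨p, -, hp⟩ := not_subset.1 (hcon (f z₀))
  obtain ⟨q, hqp, hq⟩ := not_subset.1 (hcon p)
  have hpq : q - p ≠ 0 := sub_ne_zero.2 hqp
  have hud : Differentiable ℂ fun z => 2 * (f z - p) / (q - p) - 1 :=
    (((hf.sub_const p).const_mul 2).div_const _).sub_const 1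
  obtain ⟨F, hF, hFe⟩ := exists_differentiable_cos_pi_mul_eq hud
    (fun z h => hq ⟨z, by field_simp at h; linear_combination h / 2⟩)
    (fun z h => hp ⟨z, by field_simp at h; linear_combination h / 2⟩)
  have hFn : ∀ z (n : ℤ), F z ≠ n := fun z n h => by
    have h' := hFe z
    rw [h] at h'
    rcases cos_pi_mul_intCast n with h1 | h1 <;> rw [h1] at h' <;> field_simp at h'
    · exact hq ⟨z, by linear_combination -h' / 2⟩
    · exact hp ⟨z, by linear_combination -h' / 2⟩
  obtain ⟨G, hG, hGe⟩ := exists_differentiable_cos_pi_mul_eq hF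
    (fun z => by simpa using hFn z 1) (fun z => by simpa using hFn z (-1))
  have hG0 : deriv G z₀ ≠ 0 := fun h => h0 <| by
    have hfe : f = fun z => (Complex.cos (Real.pi * Complex.cos (Real.pi * G z)) + 1) *
        (q - p) / 2 + p := by
      funext z
      rw [hGe, hFe]
      field_simp
      ring
    have hd : HasDerivAt G 0 z₀ := h ▸ (hG z₀).hasDerivAt
    rw [hfe]
    have := ((((((hd.const_mul (Real.pi : ℂ)).ccos.const_mul (Real.pi : ℂ)).ccos).add_const
      1).mul_const (q - p)).div_const 2).add_const p
    simpa using this.deriv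
  obtain ⟨w, hw⟩ := exists_ball_subset_range_of_deriv_ne_zero hG hG0 2
  obtain ⟨a, ha, n, hn⟩ := exists_dist_lt_cos_pi_mul_eq_intCast w
  obtain ⟨z, rfl⟩ := hw ha
  exact hFn z n ((hGe z).symm.trans hn)

/-! ### Injective entire functions -/

/-- The slope `q z = (f z - f 0) / z` has no zero, and `f` stays away from `f 0` outside the unit
disc, so `1 / q` is entire of linear growth, hence affine; having no zero, it is constant. -/
theorem eq_add_deriv_mul_of_injective {f : ℂ → ℂ} (hf : Differentiable ℂ f)
    (hinj : Function.Injective f) (h0 : deriv f 0 ≠ 0) (z : ℂ) :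
    f z = f 0 + deriv f 0 * z := by
  have hq : Differentiable ℂ (dslope f 0) := by
    rw [← differentiableOn_univ, Complex.differentiableOn_dslope univ_mem]
    exact hf.differentiableOn
  have hqv : ∀ z, z ≠ 0 → dslope f 0 z = (f z - f 0) / z := fun z hz => by
    rw [dslope_of_ne _ hz, slope_def_field, sub_zero]
  have hqne : ∀ z, dslope f 0 z ≠ 0 := fun z => by
    rcases eq_or_ne z 0 with rfl | hz
    · rwa [dslope_same]
    · rw [hqv z hz]
      exact div_ne_zero (sub_ne_zero.2 fun h => hz (hinj h)) hz
  set k : ℂ → ℂ := fun z => (dslope f 0 z)⁻¹ with hk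
  have hkd : Differentiable ℂ k := hq.inv hqne
  have hkne : ∀ z, k z ≠ 0 := fun z => inv_ne_zero (hqne z)
  have hopen : f '' ball 0 1 ∈ 𝓝 (f 0) := by
    have hs : HasStrictDerivAt f (deriv f 0) 0 := (hf.analyticAt 0).hasStrictDerivAt
    rw [← hs.map_nhds_eq h0]
    exact image_mem_map (ball_mem_nhds 0 one_pos)
  obtain ⟨δ, hδ, hball⟩ := Metric.mem_nhds_iff.1 hopen
  have hfar : ∀ z : ℂ, 1 ≤ ‖z‖ → δ ≤ ‖f z - f 0‖ := fun z hz => by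
    by_contra! hlt
    obtain ⟨w, hw, hwz⟩ := hball (mem_ball_iff_norm.2 hlt)
    rw [hinj hwz, mem_ball_zero_iff] at hw
    linarith
  obtain ⟨C, hC⟩ := (isCompact_closedBall (0 : ℂ) 1).exists_bound_of_continuousOn
    hkd.continuous.continuousOn
  have hC0 : 0 ≤ C := (norm_nonneg _).trans (hC 0 (mem_closedBall_self zero_le_one))
  have hgrowth : ∀ z, ‖k z‖ ≤ C + ‖z‖ / δ := fun z => by
    rcases le_total ‖z‖ 1 with hz | hz
    · exact (hC z (mem_closedBall_zero_iff.2 hz)).trans (le_add_of_nonneg_right (by positivity))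
    · have hz0 : z ≠ 0 := norm_pos_iff.1 (by linarith)
      have hkz : ‖k z‖ = ‖z‖ / ‖f z - f 0‖ := by simp only [hk, hqv z hz0, inv_div, norm_div]
      rw [hkz]
      have := hfar z hz
      have : ‖z‖ / ‖f z - f 0‖ ≤ ‖z‖ / δ := by gcongr
      linarith
  have hderiv : ∀ c, ‖deriv k c‖ ≤ C + 2 / δ := fun c => by
    have hpos : 0 < 1 + ‖c‖ := by positivity
    have h := Complex.norm_deriv_le_of_forall_mem_sphere_norm_le (C := (C + 2 / δ) * (1 + ‖c‖)) hpos
      hkd.diffContOnCl (c := c) fun w hw => by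
        have hwc : ‖w - c‖ = 1 + ‖c‖ := by rw [← dist_eq_norm]; exact hw
        have hw' : ‖w‖ ≤ 1 + 2 * ‖c‖ := by linarith [norm_le_norm_sub_add w c]
        calc ‖k w‖ ≤ C + ‖w‖ / δ := hgrowth w
          _ ≤ C * (1 + ‖c‖) + 2 * (1 + ‖c‖) / δ := by
            gcongr
            · exact le_mul_of_one_le_right hC0 (by linarith [norm_nonneg c])
            · linarith
          _ = _ := by ring
    rwa [mul_div_cancel_right₀ _ hpos.ne'] at h
  have hconst : ∀ z, deriv k z = deriv k 0 := fun z =>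
    hkd.deriv.apply_eq_apply_of_bounded
      (isBounded_iff_forall_norm_le.2 ⟨_, forall_mem_range.2 hderiv⟩) z 0
  have haff : ∀ z, k z = k 0 + deriv k 0 * z := fun z => by
    have h : ∀ x, HasDerivAt (fun z => k z - deriv k 0 * z) (deriv k x - deriv k 0) x := fun x => by
      simpa using (hkd x).hasDerivAt.fun_sub ((hasDerivAt_id x).const_mul (deriv k 0))
    have h2 := is_const_of_deriv_eq_zero (fun x => (h x).differentiableAt)
      (fun x => by rw [(h x).deriv, hconst, sub_self]) z 0
    linear_combination h2
  have hslope : deriv k 0 = 0 := by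
    by_contra hne
    refine hkne (-k 0 / deriv k 0) ?_
    rw [haff]
    field_simp
    ring
  rcases eq_or_ne z 0 with rfl | hz
  · simp
  have h := haff z
  rw [hslope, zero_mul, add_zero] at h
  simp only [hk, inv_inj, dslope_same, hqv z hz] at h
  rw [← h]
  field_simp
  ring

/-! ### Closedness of the image -/

/-- By Picard's theorem the range of `f` contains arbitrarily large circles around `0`; such a
circle lies in the image of a compact set, and the maximum principle bounds `g` inside it. -/
theorem exists_isCompact_forall_norm_le_of_comp {f : ℂ → ℂ} (hf : Differentiable ℂ f)
    (h0 : ∀ z, deriv f z ≠ 0) {K : Set ℂ} (hK : IsCompact K) :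
    ∃ L : Set ℂ, IsCompact L ∧ ∀ g : ℂ → ℂ, Differentiable ℂ g → ∀ C : ℝ,
      (∀ z ∈ L, ‖g (f z)‖ ≤ C) → ∀ w ∈ K, ‖g w‖ ≤ C := by
  obtain ⟨p, hp⟩ := exists_compl_singleton_subset_range hf (h0 0)
  obtain ⟨R₀, hR₀⟩ := hK.isBounded.subset_closedBall (0 : ℂ)
  set R := |R₀| + ‖p‖ + 1 with hR
  have hRpos : 0 < R := by positivity
  have hRp : ‖p‖ < R := by linarith [abs_nonneg R₀]
  have hopen : IsOpenMap f := isOpenMap_iff_nhds_le.2 fun z =>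
    ((hf.analyticAt z).hasStrictDerivAt.map_nhds_eq (h0 z)).ge
  have hcover : sphere (0 : ℂ) R ⊆ ⋃ n : ℕ, f '' ball 0 n := fun w hw => by
    obtain ⟨z, rfl⟩ := hp (show w ∈ ({p}ᶜ : Set ℂ) from fun h => by
      rw [mem_singleton_iff.1 h, mem_sphere_zero_iff_norm] at hw
      exact hRp.ne hw)
    obtain ⟨n, hn⟩ := exists_nat_gt ‖z‖
    exact mem_iUnion.2 ⟨n, z, mem_ball_zero_iff.2 hn, rfl⟩
  obtain ⟨n, hn⟩ := (isCompact_sphere (0 : ℂ) R).elim_directed_cover _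
    (fun n => hopen _ isOpen_ball) hcover
    (Monotone.directed_le fun m n h => image_mono (ball_subset_ball (by exact_mod_cast h)))
  refine ⟨closedBall 0 n, isCompact_closedBall _ _, fun g hg C hC w hw => ?_⟩
  refine Complex.norm_le_of_forall_mem_frontier_norm_le (isBounded_ball (x := 0) (r := R))
    hg.diffContOnCl (fun v hv => ?_) ?_
  · rw [frontier_ball _ hRpos.ne'] at hv
    obtain ⟨z, hz, rfl⟩ := hn hv
    exact hC z (ball_subset_closedBall hz)
  · rw [closure_ball _ hRpos.ne']
    exact closedBall_subset_closedBall (by linarith [le_abs_self R₀, norm_nonneg p]) (hR₀ hw)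

/-- **Hurwitz's theorem**: since `f' 0 = 1` passes to limits, a limit of functions in `elh` has
a derivative that is not identically zero, and it has no zero because the derivatives of the
approximating functions have none. -/
theorem isClosed_elh : IsClosed elh := by
  refine isClosed_of_closure_subset fun h hh => ?_
  have : (𝓝[elh] h).NeBot := mem_closure_iff_nhdsWithin_neBot.1 hh
  have hmem : ∀ᶠ g : C(ℂ, ℂ) in 𝓝[elh] h, g ∈ elh := eventually_mem_nhdsWithin
  have hlim : TendstoLocallyUniformlyOn (fun (g : C(ℂ, ℂ)) z => g z) h (𝓝[elh] h) univ :=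
    tendstoLocallyUniformlyOn_univ.2 (ContinuousMap.tendsto_iff_tendstoLocallyUniformly.1
      (tendsto_id.mono_left nhdsWithin_le_nhds))
  have hdiff : ∀ᶠ g : C(ℂ, ℂ) in 𝓝[elh] h, DifferentiableOn ℂ (fun z => g z) univ :=
    hmem.mono fun g hg => hg.1.differentiableOn
  have hh1 : Differentiable ℂ h := differentiableOn_univ.1 (hlim.differentiableOn hdiff isOpen_univ)
  have hlim' := hlim.deriv hdiff isOpen_univ
  have hd0 : deriv h 0 = 1 := tendsto_nhds_unique (hlim'.tendsto_at (mem_univ 0))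
    (tendsto_const_nhds.congr' (hmem.mono fun g hg => hg.2.2.symm))
  refine ⟨hh1, fun p hp => ?_, hd0⟩
  have han : AnalyticOnNhd ℂ (deriv h) univ := fun z _ => hh1.deriv.analyticAt z
  have hev : ∀ᶠ z in 𝓝[≠] p, deriv h z ≠ 0 :=
    (han p (mem_univ p)).eventually_eq_zero_or_eventually_ne_zero.resolve_left fun hz => by
      have := han.eqOn_zero_of_preconnected_of_eventuallyEq_zero isPreconnected_univ
        (mem_univ p) hz (mem_univ 0)
      simp [hd0] at this
  obtain ⟨s, hs, hsne⟩ := Metric.eventually_nhds_iff_ball.1 (eventually_nhdsWithin_iff.1 hev)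
  have hr : 0 < s / 2 := half_pos hs
  have hne : ∀ z ∈ sphere p (s / 2), deriv h z ≠ 0 := fun z hz => by
    have hz' : dist z p = s / 2 := hz
    refine hsne z (mem_ball.2 (by linarith)) fun h => ?_
    rw [mem_singleton_iff.1 h, dist_self] at hz'
    linarith
  obtain ⟨w, hw, hmin⟩ := (isCompact_sphere p (s / 2)).exists_isMinOn
    (NormedSpace.sphere_nonempty.2 hr.le) hh1.deriv.continuous.norm.continuousOn
  have hc : 0 < ‖deriv h w‖ := norm_pos_iff.2 (hne w hw)
  have hunif := Metric.tendstoUniformlyOn_iff.1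
    ((tendstoLocallyUniformlyOn_iff_forall_isCompact isOpen_univ).1 hlim' _ (subset_univ _)
      (isCompact_closedBall p (s / 2))) _ (half_pos hc)
  obtain ⟨g, hg, hgu⟩ := (hmem.and hunif).exists
  have hinv : ‖(deriv g p)⁻¹‖ ≤ (‖deriv h w‖ / 2)⁻¹ := by
    refine Complex.norm_le_of_forall_mem_frontier_norm_le (isBounded_ball (x := p) (r := s / 2))
      (f := fun z => (deriv g z)⁻¹) (hg.1.deriv.inv hg.2.1).diffContOnCl (fun v hv => ?_)
      (subset_closure (mem_ball_self hr))
    rw [frontier_ball _ hr.ne'] at hv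
    rw [norm_inv]
    refine inv_anti₀ (half_pos hc) ?_
    have h1 := hgu v (sphere_subset_closedBall hv)
    have h2 : ‖deriv h w‖ ≤ ‖deriv h v‖ := hmin hv
    rw [dist_eq_norm] at h1
    have h3 := norm_le_norm_sub_add (deriv h v) (deriv g v)
    simp only [Function.comp_apply] at h1
    linarith
  rw [norm_inv, inv_le_inv₀ (norm_pos_iff.2 (hg.2.1 p)) (half_pos hc)] at hinv
  have h1 := hgu p (mem_closedBall_self hr.le)
  simp only [Function.comp_apply, hp, dist_zero_left] at h1
  linarith

/-- Composition with `f` embeds the complete space `elh` uniformly, so its image is complete. -/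
theorem isClosed_rightImage {f : C(ℂ, ℂ)} (hf : f ∈ elh) : IsClosed (rightImage f) := by
  have hb := Metric.uniformity_basis_dist_le (α := ℂ).compactConvergenceUniformity (α := ℂ)
  have hind : IsUniformInducing fun g : elh => (g : C(ℂ, ℂ)).comp f := by
    have hbs := hb.comap fun q : elh × elh => ((q.1 : C(ℂ, ℂ)), (q.2 : C(ℂ, ℂ)))
    rw [← uniformity_subtype] at hbs
    refine (hbs.isUniformInducing_iff hb).2 ⟨?_, ?_⟩
    · exact (hbs.uniformContinuous_iff hb).1
        ((ContinuousMap.uniformContinuous_comp_left f).comp uniformContinuous_subtype_val)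
    · rintro ⟨K, ε⟩ ⟨hK, hε⟩
      obtain ⟨L, hL, hLK⟩ := exists_isCompact_forall_norm_le_of_comp hf.1 hf.2.1 hK
      refine ⟨⟨L, ε⟩, ⟨hL, hε⟩, fun g₁ g₂ hg w hw => ?_⟩
      have := hLK (fun z => g₁.1 z - g₂.1 z) (g₁.2.1.sub g₂.2.1) ε
        (fun z hz => by simpa [dist_eq_norm] using hg z hz) w hw
      simpa [dist_eq_norm] using this
  have : CompleteSpace elh := isClosed_elh.completeSpace_coe
  have h := hind.isComplete_range.isClosed
  rwa [show range (fun g : elh => (g : C(ℂ, ℂ)).comp f) = rightImage f by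
    rw [rightImage, image_eq_range]] at h

/-! ### Perturbations and empty interior -/

/-- Given `h` without critical points and `W` entire with `W 0 = 0`, the primitives `H ε` of
`h' exp (ε W' / h')` have no critical points either, and `H ε = h + ε W + O(ε²)` uniformly on
compact sets. -/
theorem exists_perturbation {h W : ℂ → ℂ} (hh : Differentiable ℂ h) (h0 : ∀ z, deriv h z ≠ 0)
    (hW : Differentiable ℂ W) (hW0 : W 0 = 0) (hW0' : deriv W 0 = 0) :
    ∃ H : ℂ → C(ℂ, ℂ), (∀ ε, H ε ∈ entireLocalHomeo ∧ deriv (H ε) 0 = deriv h 0) ∧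
      ∀ R : ℝ, ∃ C, ∀ ε : ℂ, ‖ε‖ ≤ 1 → ∀ z ∈ closedBall (0 : ℂ) R,
        ‖H ε z - h z - ε * W z‖ ≤ C * ‖ε‖ ^ 2 := by
  have hv : Differentiable ℂ fun z => deriv W z / deriv h z := hW.deriv.div hh.deriv h0
  have hprim : ∀ ε : ℂ, ∃ P : ℂ → ℂ, P 0 = h 0 ∧
      ∀ z ∈ univ, HasDerivAt P (deriv h z * Complex.exp (ε * (deriv W z / deriv h z))) z :=
    fun ε => (hh.deriv.mul (hv.const_mul ε).cexp).isExactOn_univ.with_val_at 0 (h 0)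
  choose P hP0 hP using hprim
  have hPd : ∀ ε, Differentiable ℂ (P ε) := fun ε z => (hP ε z (mem_univ z)).differentiableAt
  refine ⟨fun ε => ⟨P ε, (hPd ε).continuous⟩, fun ε => ⟨⟨hPd ε, fun z => ?_⟩, ?_⟩, fun R => ?_⟩
  · exact (hP ε z (mem_univ z)).deriv ▸ mul_ne_zero (h0 z) (Complex.exp_ne_zero _)
  · exact (hP ε 0 (mem_univ 0)).deriv.trans (by simp [hW0'])
  have hcont : Continuous fun z => ‖deriv h z‖ * (‖deriv W z / deriv h z‖ ^ 2 *
      Real.exp ‖deriv W z / deriv h z‖) := by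
    have h1 := hh.deriv.continuous
    have h2 := hv.continuous
    fun_prop
  obtain ⟨M, hM⟩ := (isCompact_closedBall (0 : ℂ) R).exists_bound_of_continuousOn hcont.continuousOn
  refine ⟨M * R, fun ε hε z hz => ?_⟩
  have hR : 0 ≤ R := (norm_nonneg z).trans (mem_closedBall_zero_iff.1 hz)
  have hd : ∀ x, HasDerivAt (fun z => P ε z - h z - ε * W z)
      (deriv h x * (Complex.exp (ε * (deriv W x / deriv h x)) - 1 -
        ε * (deriv W x / deriv h x))) x := fun x => by
    refine (((hP ε x (mem_univ x)).fun_sub (hh x).hasDerivAt).fun_sub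
      ((hW x).hasDerivAt.const_mul ε)).congr_deriv ?_
    have := h0 x
    field_simp
  have hbound : ∀ x ∈ closedBall (0 : ℂ) R, ‖deriv h x * (Complex.exp
      (ε * (deriv W x / deriv h x)) - 1 - ε * (deriv W x / deriv h x))‖ ≤ M * ‖ε‖ ^ 2 :=
    fun x hx => by
      have h1 := Complex.norm_exp_sub_sum_le_norm_mul_exp (ε * (deriv W x / deriv h x)) 2
      rw [Finset.sum_range_succ, Finset.sum_range_one] at h1
      simp only [pow_zero, Nat.factorial, Nat.cast_one, div_one, pow_one, zero_add, mul_one,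
        Nat.succ_eq_add_one, ← sub_sub] at h1
      have h2 := (le_abs_self _).trans (hM x hx)
      set v := deriv W x / deriv h x
      rw [norm_mul]
      calc ‖deriv h x‖ * ‖Complex.exp (ε * v) - 1 - ε * v‖
          ≤ ‖deriv h x‖ * (‖ε * v‖ ^ 2 * Real.exp ‖ε * v‖) := by gcongr
        _ ≤ ‖deriv h x‖ * (‖ε * v‖ ^ 2 * Real.exp ‖v‖) := by
            gcongr
            rw [norm_mul]
            exact mul_le_of_le_one_left (norm_nonneg v) hε
        _ = (‖deriv h x‖ * (‖v‖ ^ 2 * Real.exp ‖v‖)) * ‖ε‖ ^ 2 := by rw [norm_mul]; ring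
        _ ≤ M * ‖ε‖ ^ 2 := by gcongr
  have hmv := (convex_closedBall (0 : ℂ) R).norm_image_sub_le_of_norm_hasDerivWithin_le
    (fun x _ => (hd x).hasDerivWithinAt) hbound (mem_closedBall_self hR) hz
  simp only [hP0, hW0, sub_self, mul_zero, sub_zero] at hmv
  refine hmv.trans ?_
  have hM0 : 0 ≤ M := (norm_nonneg _).trans (hM z hz)
  calc M * ‖ε‖ ^ 2 * ‖z‖ ≤ M * ‖ε‖ ^ 2 * R := by
        gcongr
        exact mem_closedBall_zero_iff.1 hz
    _ = M * R * ‖ε‖ ^ 2 := by ring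

/-- An entire function without critical points that identifies `a` and `b` is a limit of such
functions, with the same derivative at `0`, that separate `a` and `b`. -/
theorem exists_tendsto_ne {h : C(ℂ, ℂ)} (hh : h ∈ entireLocalHomeo) {a b : ℂ} (hab : a ≠ b)
    (hhab : h a = h b) :
    ∃ H : ℂ → C(ℂ, ℂ), (∀ ε, H ε ∈ entireLocalHomeo ∧ deriv (H ε) 0 = deriv h 0) ∧
      Tendsto H (𝓝[≠] 0) (𝓝 h) ∧ ∀ᶠ ε in 𝓝[≠] 0, H ε a ≠ H ε b := by
  -- The squares and the cubes of two distinct numbers cannot both agree.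
  obtain ⟨W, hW, hW0, hW0', hWab⟩ : ∃ W : ℂ → ℂ, Differentiable ℂ W ∧ W 0 = 0 ∧ deriv W 0 = 0 ∧
      W a ≠ W b := by
    by_cases h2 : a ^ 2 = b ^ 2
    · refine ⟨fun z => z ^ 3, by fun_prop, by simp, by simp, fun h3 => hab ?_⟩
      have h3' : a ^ 3 = b ^ 3 := h3
      have hb : b ^ 2 * (a - b) = 0 := by linear_combination h3' - a * h2
      rcases mul_eq_zero.1 hb with hb | hb
      · rw [hb] at h2
        rw [pow_eq_zero_iff two_ne_zero] at h2 hb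
        rw [h2, hb]
      · exact sub_eq_zero.1 hb
    · exact ⟨fun z => z ^ 2, by fun_prop, by simp, by simp, h2⟩
  obtain ⟨H, hH, hest⟩ := exists_perturbation hh.1 hh.2 hW hW0 hW0'
  have hsmall : ∀ δ > 0, ∀ᶠ ε : ℂ in 𝓝[≠] 0, ‖ε‖ < δ := fun δ hδ =>
    nhdsWithin_le_nhds (mem_of_superset (ball_mem_nhds (0 : ℂ) hδ) fun ε => mem_ball_zero_iff.1)
  refine ⟨H, hH, ?_, ?_⟩
  · refine ContinuousMap.tendsto_iff_forall_isCompact_tendstoUniformlyOn.2 fun K hK => ?_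
    obtain ⟨R, hR⟩ := hK.isBounded.subset_closedBall (0 : ℂ)
    obtain ⟨C, hC⟩ := hest R
    obtain ⟨B, hB⟩ := (isCompact_closedBall (0 : ℂ) R).exists_bound_of_continuousOn
      hW.continuous.continuousOn
    refine Metric.tendstoUniformlyOn_iff.2 fun η hη => ?_
    have hpos : 0 < |C| + |B| + 1 := by positivity
    filter_upwards [hsmall 1 one_pos, hsmall (η / (|C| + |B| + 1)) (by positivity)]
      with ε h1 h2 z hz
    rw [lt_div_iff₀ hpos] at h2
    have h3 := hC ε h1.le z (hR hz)
    have h4 := hB z (hR hz)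
    have h5 : ‖H ε z - h z‖ ≤ C * ‖ε‖ ^ 2 + ‖ε‖ * ‖W z‖ := by
      rw [← norm_mul]
      linarith [norm_le_norm_sub_add (H ε z - h z) (ε * W z)]
    rw [dist_comm, dist_eq_norm]
    calc ‖H ε z - h z‖ ≤ C * ‖ε‖ ^ 2 + ‖ε‖ * ‖W z‖ := h5
      _ ≤ |C| * (‖ε‖ * 1) + ‖ε‖ * |B| := by
          rw [sq]
          gcongr
          · exact le_abs_self C
          · exact h4.trans (le_abs_self B)
      _ ≤ ‖ε‖ * (|C| + |B| + 1) := by linarith [norm_nonneg ε]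
      _ < η := h2
  · obtain ⟨C, hC⟩ := hest (‖a‖ + ‖b‖)
    have hWpos : 0 < ‖W a - W b‖ := norm_pos_iff.2 (sub_ne_zero.2 hWab)
    have hpos : 0 < 2 * |C| + 1 := by positivity
    filter_upwards [hsmall 1 one_pos, hsmall (‖W a - W b‖ / (2 * |C| + 1)) (by positivity),
      self_mem_nhdsWithin] with ε h1 h2 hε heq
    have hεpos : 0 < ‖ε‖ := norm_pos_iff.2 hε
    have ha := hC ε h1.le a (mem_closedBall_zero_iff.2 (by linarith [norm_nonneg b]))
    have hb := hC ε h1.le b (mem_closedBall_zero_iff.2 (by linarith [norm_nonneg a]))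
    have h3 := norm_sub_le (H ε b - h b - ε * W b) (H ε a - h a - ε * W a)
    rw [show H ε b - h b - ε * W b - (H ε a - h a - ε * W a) = ε * (W a - W b) by
      rw [heq, hhab]; ring, norm_mul] at h3
    rw [lt_div_iff₀ hpos] at h2
    have h4 : ‖ε‖ * ‖W a - W b‖ ≤ ‖ε‖ * (‖ε‖ * (2 * |C| + 1)) := by
      nlinarith [le_abs_self C, sq_nonneg ‖ε‖]
    exact absurd (le_of_mul_le_mul_left h4 hεpos) h2.not_ge

/-- All functions in the image identify two distinct points identified by `f`, which is destroyed
by arbitrarily small perturbations. -/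
theorem interior_rightImageIn_eq_empty {f : C(ℂ, ℂ)} (hf : f ∈ elh) (hfA : f ∉ translations)
    {X : Set C(ℂ, ℂ)} (hX : X ⊆ entireLocalHomeo)
    (hX' : ∀ h ∈ X, ∀ H ∈ entireLocalHomeo, deriv H 0 = deriv h 0 → H ∈ X) :
    interior (rightImageIn X f) = ∅ := by
  have hninj : ¬ Function.Injective f := fun hinj => hfA ⟨f 0, fun z => by
    rw [eq_add_deriv_mul_of_injective hf.1 hinj (hf.2.1 0) z, hf.2.2, one_mul, add_comm]⟩
  simp only [Function.Injective, not_forall] at hninj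
  obtain ⟨a, b, hfab, hab⟩ := hninj
  have hid : ∀ h ∈ rightImage f, h a = h b := by
    rintro _ ⟨g, -, rfl⟩
    exact congrArg g hfab
  refine eq_empty_iff_forall_notMem.2 fun h hh => ?_
  obtain ⟨H, hH, hlim, hne⟩ := exists_tendsto_ne (hX h.2) hab
    (hid h (interior_subset hh : h ∈ rightImageIn X f))
  have hlim' : Tendsto (fun ε => (⟨H ε, hX' h h.2 _ (hH ε).1 (hH ε).2⟩ : X)) (𝓝[≠] 0) (𝓝 h) :=
    tendsto_subtype_rng.2 hlim
  obtain ⟨ε, hε, hε'⟩ := ((hlim'.eventually (mem_interior_iff_mem_nhds.1 hh)).and hne).exists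
  exact hε' (hid _ hε)

/-! ### The boundary of the image -/

theorem rightImage_subset_entireLocalHomeo {f : C(ℂ, ℂ)} (hf : f ∈ elh) :
    rightImage f ⊆ entireLocalHomeo := by
  rintro _ ⟨g, hg, rfl⟩
  refine ⟨hg.1.comp hf.1, fun z => ?_⟩
  rw [ContinuousMap.coe_comp, deriv_comp z (hg.1 _) (hf.1 z)]
  exact mul_ne_zero (hg.2.1 _) (hf.2.1 z)

theorem isClosed_rightImageIn {f : C(ℂ, ℂ)} (hf : f ∈ elh) (X : Set C(ℂ, ℂ)) :
    IsClosed (rightImageIn X f) :=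
  (isClosed_rightImage hf).preimage continuous_subtype_val

theorem theorem3p18 (f : C(ℂ, ℂ)) (hf : f ∈ elh) (hfA : f ∉ translations) :
    -- in `elh(ℂ)`
    (IsClosed (rightImageIn elh f) ∧
      interior (rightImageIn elh f) = ∅ ∧
      frontier (rightImageIn elh f) = rightImageIn elh f) ∧
    -- if `f(0) = 0`, nothing of the image lies outside `elh(ℂ)`
    (f 0 = 0 → rightImage f ⊆ elh) ∧
    -- for every `f(0)`, the whole image lies in the unnormalized space, and the same holds there
    rightImage f ⊆ entireLocalHomeo ∧
    (IsClosed (rightImageIn entireLocalHomeo f) ∧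
      interior (rightImageIn entireLocalHomeo f) = ∅ ∧
      frontier (rightImageIn entireLocalHomeo f) = rightImageIn entireLocalHomeo f) := by
  have key : ∀ X : Set C(ℂ, ℂ), X ⊆ entireLocalHomeo →
      (∀ h ∈ X, ∀ H ∈ entireLocalHomeo, deriv H 0 = deriv h 0 → H ∈ X) →
      IsClosed (rightImageIn X f) ∧ interior (rightImageIn X f) = ∅ ∧
        frontier (rightImageIn X f) = rightImageIn X f := fun X hX hX' => by
    have hc := isClosed_rightImageIn hf X
    have hi := interior_rightImageIn_eq_empty hf hfA hX hX'
    exact ⟨hc, hi, by rw [hc.frontier_eq, hi, sdiff_empty]⟩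
  refine ⟨key elh (fun h hh => ⟨hh.1, hh.2.1⟩)
      (fun h hh H hH hd => ⟨hH.1, hH.2, hd.trans hh.2.2⟩), fun hf0 => ?_,
    rightImage_subset_entireLocalHomeo hf, key _ Subset.rfl fun _ _ _ hH _ => hH⟩
  rintro _ ⟨g, hg, rfl⟩
  obtain ⟨hd, hne⟩ := rightImage_subset_entireLocalHomeo hf ⟨g, hg, rfl⟩
  refine ⟨hd, hne, ?_⟩
  rw [ContinuousMap.coe_comp, deriv_comp 0 (hg.1 _) (hf.1 0), hf0, hg.2.2, hf.2.2, one_mul]
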